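/- Let $K$ be a compact line, i.e. a totally ordered set which is compact in its order topology. *Terminology.* A point $t\in K$ is *right isolated* (resp. *left isolated*) if $t=\max K$ (resp. $t=\min K$) or there is $s>t$ with $]t,s[\,=\emptyset$ (resp. $s<t$ with $]s,t[\,=\emptyset$); it is *internal* if it is neither. The *right character* of $t$ is $\omega$ if $t$ is right isolated, and otherwise it is the least cardinality of a set $A\subset{}]t,\max K]$ with $\inf A=t$. The point $t$ has a *separable adjacency* if it belongs to a separable convex subset of $K$ with more than one point. For $A\subset K$, let $\mathrm{Der}(A,K)$ be the set of all $t\in A\setminus\{\min K,\max K\}$ such that $]s_1,t[\,\cap A\neq\emptyset$ and $]t,s_2[\,\cap A\neq\emptyset$ for all $s_1<t<s_2$ in $K$; put $\mathrm{Der}_0(A,K)=A$ and $\mathrm{Der}_{n+1}(A,K)=\mathrm{Der}(\mathrm{Der}_n(A,K),K)$. The set $A$ has *finite two-sided height* in $K$ if $\mathrm{Der}_n(A,K)=\emptyset$ for some $n\in\mathbb N$. Let $\mathrm{NBV}(K)$ be the space of right-continuous maps $F:K\to\mathbb R$ of bounded variation, identified with the dual of $C(K)$, i.e. with the space of finite regular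 signed Borel measures on $K$, through $F(t)=\mu([\min K,t])$ for $t\in K$. A family $(F_i)_{i\in I}$ in $\mathrm{NBV}(K)$, with corresponding measures $\mu_i$, is *weak\*-null* if $\lim_{i\in I}\int_K f\,d\mu_i=0$ for every $f\in C(K)$, where $\lim_{i\in I}x_i=0$ means that $(x_i)_{i\in I}\in c_0(I)$, i.e. that $\{i\in I:|x_i|\ge\varepsilon\}$ is finite for every $\varepsilon>0$. A family $(F_i)_{i\in I}$ of real-valued maps is *of type $c_0\ell_1$ over* a set $Q$ if there are real numbers $a_{i,t},b_{i,t}$ ($i\in I$, $t\in Q$) with $F_i(t)=a_{i,t}+b_{i,t}$, with $\lim_{i\in I}a_{i,t}=0$ for all $t\in Q$, and with $\sup_{i\in I}\sum_{t\in Q}|b_{i,t}|<+\infty$. Finally, $K$ is *separably determined* if for every set $I$, every weak\*-null family $(F_i)_{i\in I}$ in $\mathrm{NBV}(K)$ and every $Q\subset K$ the following holds: if for every closed separable $H\subset K$ the set $\{t\in Q\cap(H\setminus H^+):(F_i(t))_{i\in I}\notin c_0(I)\}$ is countable, where $H^+$ is the set of right isolated points of the compact line $H$, then $(F_i)_{i\in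 I}$ is of type $c_0\ell_1$ over $Q$. **Theorem.** If the set of internal points of $K$ that have countable right character and do not have a separable adjacency in $K$ can be covered by countably many subsets of $K$ of finite two-sided height in $K$, then $K$ is separably determined. -/

import Mathlib

open Set Filter Topology MeasureTheory Cardinal
open scoped ENNReal

universe u v

namespace CompactLine

noncomputable section

/-! A compact line is a linear order which is compact in its order topology. In the definitions
below `K` is a linear order with the order topology; compactness is assumed in the theorem. -/

/-- The set of right isolated points of a linear order: the maximum, if there is one, and the
points with an immediate successor. -/
def rightIsolated (K : Type u) [LinearOrder K] : Set K :=
  {t | IsTop t ∨ ∃ s, t < s ∧ Ioo t s = ∅}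

/-- The set of left isolated points of a linear order: the minimum, if there is one, and the
points with an immediate predecessor. -/
def leftIsolated (K : Type u) [LinearOrder K] : Set K :=
  {t | IsBot t ∨ ∃ s, s < t ∧ Ioo s t = ∅}

/-- The points that are neither right isolated nor left isolated. -/
def internalPoints (K : Type u) [LinearOrder K] : Set K :=
  (rightIsolated K ∪ leftIsolated K)ᶜ

open Classical in
/-- The right character of `t`: it is `ω` if `t` is right isolated; otherwise it is the least
cardinality of a set of points to the right of `t` whose infimum is `t`. -/
def rightCharacter {K : Type u} [LinearOrder K] (t : K) : Cardinal.{u} :=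
  if t ∈ rightIsolated K then ℵ₀
  else sInf {c | ∃ A : Set K, A ⊆ Ioi t ∧ IsGLB A t ∧ #A = c}

/-- `t` has a separable adjacency: it belongs to a convex subset with more than one point which is
separable in the subspace topology. -/
def HasSeparableAdjacency {K : Type u} [LinearOrder K] [TopologicalSpace K] (t : K) : Prop :=
  ∃ C : Set K, C.OrdConnected ∧ C.Nontrivial ∧ TopologicalSpace.SeparableSpace C ∧ t ∈ C

/-- The two-sided derivative of `A` in `K`: the points of `A`, other than the minimum and the
maximum of `K`, that are accumulated by points of `A` from both sides. -/
def twoSidedDer {K : Type u} [LinearOrder K] (A : Set K) : Set K :=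
  {t | t ∈ A ∧ ¬ IsBot t ∧ ¬ IsTop t ∧
    ∀ s₁ s₂ : K, s₁ < t → t < s₂ → (Ioo s₁ t ∩ A).Nonempty ∧ (Ioo t s₂ ∩ A).Nonempty}

/-- The iterated two-sided derivatives. -/
def iterDer {K : Type u} [LinearOrder K] : ℕ → Set K → Set K
  | 0, A => A
  | n + 1, A => twoSidedDer (iterDer n A)

/-- `A` has finite two-sided height in `K`. -/
def FiniteTwoSidedHeight {K : Type u} [LinearOrder K] (A : Set K) : Prop :=
  ∃ n : ℕ, iterDer n A = ∅

/-- The space `NBV(K)`: right-continuous real-valued maps of bounded variation. -/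
def NBV (K : Type u) [LinearOrder K] [TopologicalSpace K] : Set (K → ℝ) :=
  {F | BoundedVariationOn F univ ∧ ∀ t, ContinuousWithinAt F (Ici t) t}

/-- The integral of a function against a finite signed measure, through the Jordan
decomposition. -/
def signedIntegral {K : Type u} [MeasurableSpace K] (μ : SignedMeasure K) (f : K → ℝ) : ℝ :=
  ∫ x, f x ∂μ.toJordanDecomposition.posPart - ∫ x, f x ∂μ.toJordanDecomposition.negPart

/-- The finite signed Borel measure `μ` is regular and corresponds to `F` under the identification
of `M(K) = C(K)*` with `NBV(K)`, that is, `F t = μ [min K, t]` for all `t`. On a compact line every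
member of `NBV(K)` corresponds in this way to exactly one regular measure. -/
def Represents {K : Type u} [LinearOrder K] [TopologicalSpace K] [MeasurableSpace K]
    (μ : SignedMeasure K) (F : K → ℝ) : Prop :=
  μ.totalVariation.Regular ∧ ∀ t, F t = μ (Iic t)

/-- A family `(x i)` of real numbers is in `c₀(I)`: for every `ε > 0` one has `|x i| < ε` for all
but finitely many `i`. -/
def InC0 {I : Type v} (x : I → ℝ) : Prop :=
  Tendsto x cofinite (𝓝 0)

/-- A family in `NBV(K)` is weak*-null: the integrals of every continuous function against the
corresponding measures form a family in `c₀(I)`. -/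
def IsWeakStarNull {K : Type u} [LinearOrder K] [TopologicalSpace K] [MeasurableSpace K]
    {I : Type v} (F : I → K → ℝ) : Prop :=
  (∀ i, F i ∈ NBV K) ∧
    ∃ μ : I → SignedMeasure K, (∀ i, Represents (μ i) (F i)) ∧
      ∀ f : C(K, ℝ), InC0 fun i => signedIntegral (μ i) f

/-- A family of real-valued maps on a set is of type `c₀ℓ₁`. -/
def IsTypeC0L1 {Q : Type u} {I : Type v} (F : I → Q → ℝ) : Prop :=
  ∃ a b : I → Q → ℝ, (∀ i t, F i t = a i t + b i t) ∧ (∀ t, InC0 fun i => a i t) ∧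
    ⨆ i, ∑' t, ENNReal.ofReal |b i t| < ∞

/-- A family of real-valued maps is of type `c₀ℓ₁` over the subset `S`. -/
def IsTypeC0L1Over {K : Type u} {I : Type v} (F : I → K → ℝ) (S : Set K) : Prop :=
  IsTypeC0L1 fun i (t : S) => F i t

/-- `K` is separably determined: a weak*-null family `F` in `NBV(K)` is of type `c₀ℓ₁` over a set
`Q` as soon as, for every closed separable `H`, the set of those `t ∈ Q ∩ (H \ H⁺)` with
`(F i t)` not in `c₀(I)` is countable; here `H⁺` is the set of right isolated points of `H`, as a
linear order in its own right. -/
def SeparablyDetermined (K : Type u) [LinearOrder K] [TopologicalSpace K] [MeasurableSpace K] :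
    Prop :=
  ∀ (I : Type v) (F : I → K → ℝ), IsWeakStarNull F → ∀ Q : Set K,
    (∀ H : Set K, IsClosed H → TopologicalSpace.SeparableSpace H →
      {t ∈ Q ∩ (H \ (Subtype.val '' rightIsolated H)) | ¬ InC0 fun i => F i t}.Countable) →
    IsTypeC0L1Over F Q

end

end CompactLine

/-! Let `f` be continuous with values in [0,1], equal to 1 up to t and to 0 from some s > t on. Then
|F_i(t) - ∫ f dμ_i| ≤ |μ_i|(]t,s[); if the transition takes place to the left of t, the bound is
|μ_i|(]s,t]). The integrals are in c₀(I) and the variations |μ_i|(K) are bounded by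
Banach–Steinhaus. So F is of type c₀ℓ₁ over every set whose points carry pairwise disjoint intervals
of this kind (`isTypeC0L1Over_of_Ioo`, `isTypeC0L1Over_of_Ioc`).

Such sets can be glued countably many at a time (`isTypeC0L1_of_iUnion`). This rests on two facts:
for each t only countably many F_i(t) are nonzero (`countable_support`), and over finite sets the
ℓ₁-norms are eventually below a constant independent of the set (`eventually_sum_le`).

It remains to cover Q by countably many good sets. The points where F_i(t) is in c₀(I) are harmless;
they include the right isolated points and those of uncountable right character. Left isolated
points are separated by their predecessors. A set of finite two-sided height is peeled by
derivatives, since a removed internal point has a one-sided neighbourhood missing the current set.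
Points with a separable adjacency use the hypothesis on Q: each separable interval contains only
countably many relevant points (`isTypeC0L1Over_of_hasSeparableAdjacency`). -/

namespace CompactLine

/-! ### Gluing countably many c₀ℓ₁ decompositions -/

section Combinatorics

variable {Q : Type u} {I : Type v}

theorem countable_setOf_reflTransGen {α : Type*} {r : α → α → Prop}
    (hr : ∀ a, {b | r a b}.Countable) (a : α) : {b | Relation.ReflTransGen r a b}.Countable := by
  let S : ℕ → Set α := fun n => Nat.rec {a} (fun _ s => ⋃ x ∈ s, {y | r x y}) n
  have hS : ∀ n, (S n).Countable := by
    intro n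
    induction n with
    | zero => exact countable_singleton a
    | succ n ih => exact ih.biUnion fun x _ => hr x
  refine (countable_iUnion hS).mono ?_
  intro b hb
  induction hb with
  | refl => exact mem_iUnion.2 ⟨0, rfl⟩
  | tail _ hbc ih =>
    obtain ⟨n, hn⟩ := mem_iUnion.1 ih
    exact mem_iUnion.2 ⟨n + 1, mem_biUnion hn hbc⟩

theorem InC0.countable_support {x : I → ℝ} (h : InC0 x) : {i | x i ≠ 0}.Countable :=
  Filter.Tendsto.countable_compl_preimage_ker h |>.mono (by
    intro i hi
    simpa using hi)

/-- A family which is of type `c₀ℓ₁` over countably many sets is so over their union, provided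
that it is eventually bounded by the same constant in `ℓ₁`-norm over all finite sets. -/
theorem isTypeC0L1_of_iUnion {F : I → Q → ℝ} (hsupp : ∀ t, {i | F i t ≠ 0}.Countable)
    {C : ℝ} (hfin : ∀ T : Finset Q, ∀ᶠ i in cofinite, ∑ t ∈ T, |F i t| ≤ C)
    (S : ℕ → Set Q) (hS : ∀ t, ∃ n, t ∈ S n)
    (hF : ∀ n, IsTypeC0L1 fun i (t : S n) => F i t) : IsTypeC0L1 F := by
  classical
  choose a b hab ha hb using hF
  choose n hn using hS
  -- `R` marks the entries for which the given c₀ part may not suffice. It is countable in each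
  -- variable, so linking points of `Q` that share an index `i` yields countable classes.
  let R : I → Q → Prop := fun i t => F i t ≠ 0 ∧ b (n t) i ⟨t, hn t⟩ ≠ 0
  have hRi : ∀ i, {t | R i t}.Countable := by
    intro i
    have h1 : ∀ m, {t : S m | b m i t ≠ 0}.Countable := by
      intro m
      have h2 : ∑' t, ENNReal.ofReal |b m i t| ≠ ∞ :=
        ((le_iSup (fun i => ∑' t, ENNReal.ofReal |b m i t|) i).trans_lt (hb m)).ne
      refine (Summable.countable_support_ennreal h2).mono ?_
      intro t ht
      simpa using ht
    refine (countable_iUnion fun m => (h1 m).image Subtype.val).mono ?_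
    intro t ht
    exact mem_iUnion.2 ⟨n t, ⟨t, hn t⟩, ht.2, rfl⟩
  have hRt : ∀ t, {i | R i t}.Countable := fun t => (hsupp t).mono fun i hi => hi.1
  let r : Q → Q → Prop := fun t t' => ∃ i, R i t ∧ R i t'
  have hr : ∀ t, {t' | r t t'}.Countable := by
    intro t
    refine ((hRt t).biUnion fun i _ => hRi i).mono ?_
    rintro t' ⟨i, h1, h2⟩
    exact mem_biUnion h1 h2
  let c : Q → Set Q := fun t => {t' | Relation.EqvGen r t t'}
  have hc : ∀ t, (c t).Countable := by
    intro t
    refine (countable_setOf_reflTransGen hr t).mono ?_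
    intro t' h
    have : Std.Symm r := ⟨fun x y ⟨i, h1, h2⟩ => ⟨i, h2, h1⟩⟩
    induction h with
    | rel x y h => exact .single h
    | refl x => exact .refl
    | symm x y _ ih => exact Std.Symm.symm _ _ ih
    | trans x y z _ _ h1 h2 => exact h1.trans h2
  let rep : Q → Q := fun t => Quot.out (Quot.mk r t)
  have hrep : ∀ t, Relation.EqvGen r (rep t) t := fun t =>
    Quot.eqvGen_exact (Quot.out_eq (Quot.mk r t))
  have hrepeq : ∀ t t', Relation.EqvGen r t t' → rep t = rep t' := by
    intro t t' h
    simp only [rep]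
    rw [Quot.eqvGen_sound h]
  have hinj : ∀ t, ∃ g : Q → ℕ, InjOn g (c t) := fun t => (countable_iff_exists_injOn.1 (hc t))
  choose g hg using hinj
  -- `p` numbers each class injectively, so each point determines a finite initial segment of its
  -- class.
  let p : Q → ℕ := fun t => g (rep t) t
  have hfinite : ∀ t, {t' | rep t' = rep t ∧ p t' ≤ p t}.Finite := by
    intro t
    refine Set.Finite.of_finite_image (f := p) ((finite_Iic (p t)).subset ?_) ?_
    · rintro _ ⟨t', h, rfl⟩
      exact h.2
    · intro x hx y hy hxy
      refine hg (rep t) ?_ ?_ ?_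
      · show Relation.EqvGen r (rep t) x
        rw [← hx.1]; exact hrep x
      · show Relation.EqvGen r (rep t) y
        rw [← hy.1]; exact hrep y
      · simpa only [p, hx.1, hy.1] using hxy
  let T : Q → Finset Q := fun t => (hfinite t).toFinset
  -- The new ℓ₁ part takes the whole of `F i t` at marked entries, provided that the sum over the
  -- initial segment up to `t` is at most `C`. For fixed `t` this proviso fails for finitely many
  -- `i` only.
  let B : I → Q → ℝ := fun i t => if R i t ∧ ∑ t' ∈ T t, |F i t'| ≤ C then F i t else 0
  refine ⟨fun i t => F i t - B i t, B, fun i t => by ring, ?_, ?_⟩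
  · intro t
    have h0 := ha (n t) ⟨t, hn t⟩
    refine squeeze_zero_norm' ?_ (tendsto_norm_zero.comp h0)
    filter_upwards [hfin (T t)] with i hi
    by_cases hR : R i t
    · simp [B, hR, hi]
    · have : B i t = 0 := by simp [B, hR]
      rw [this, sub_zero]
      by_cases hF0 : F i t = 0
      · simp [hF0]
      · have hb0 : b (n t) i ⟨t, hn t⟩ = 0 := by
          by_contra h
          exact hR ⟨hF0, h⟩
        have h3 := hab (n t) i ⟨t, hn t⟩
        rw [hb0, add_zero] at h3
        simp only [Function.comp]
        rw [← h3]
  · refine lt_of_le_of_lt (iSup_le fun i => ?_) (ENNReal.ofReal_lt_top (r := max C 0))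
    rw [ENNReal.tsum_eq_iSup_sum]
    refine iSup_le fun U => ?_
    rw [← ENNReal.ofReal_sum_of_nonneg fun _ _ => abs_nonneg _]
    refine ENNReal.ofReal_le_ofReal ?_
    rw [← Finset.sum_filter_of_ne (p := fun t => B i t ≠ 0) (fun x _ h => by simpa using h)]
    rcases (U.filter fun t => B i t ≠ 0).eq_empty_or_nonempty with h | h
    · simp [h]
    -- For fixed `i` all points with `B i t ≠ 0` lie in one class, so the initial segment of the one
    -- with the largest number contains those in `U`.
    obtain ⟨t, ht, hmax⟩ := Finset.exists_max_image _ p h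
    have hB : ∀ t', B i t' ≠ 0 → R i t' ∧ ∑ s ∈ T t', |F i s| ≤ C := by
      intro t' h
      by_contra h'
      exact h (by simp only [B, if_neg h'])
    have ht' := hB t (Finset.mem_filter.1 ht).2
    refine le_trans ?_ (ht'.2.trans (le_max_left _ _))
    refine (Finset.sum_le_sum fun s hs => ?_).trans
      (Finset.sum_le_sum_of_subset_of_nonneg (t := T t) ?_ fun _ _ _ => abs_nonneg _)
    · simp only [B]
      split_ifs
      · rfl
      · simp
    · intro s hs
      have hs' := hB s (Finset.mem_filter.1 hs).2
      simp only [T, Finite.mem_toFinset, mem_ofPred_eq]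
      exact ⟨hrepeq _ _ (.rel _ _ ⟨i, hs'.1, ht'.1⟩), hmax s hs⟩

end Combinatorics

/-! ### Variation of regular signed measures and continuous approximations of indicators -/

section Measure

set_option linter.unusedSectionVars false

variable {K : Type u} [LinearOrder K] [TopologicalSpace K] [OrderTopology K]
    [CompactSpace K] [MeasurableSpace K] [BorelSpace K]

theorem integrable_continuousMap (f : C(K, ℝ)) (ν : Measure K) [IsFiniteMeasure ν] :
    Integrable f ν :=
  f.continuous.integrable_of_hasCompactSupport (HasCompactSupport.of_compactSpace _)

theorem abs_measureReal_Iic_sub_integral_le (ν : Measure K) [IsFiniteMeasure ν] (f : C(K, ℝ))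
    {t : K} {J : Set K} (hJ : MeasurableSet J)
    (h : ∀ x, |(Iic t).indicator (1 : K → ℝ) x - f x| ≤ J.indicator (1 : K → ℝ) x) :
    |ν.real (Iic t) - ∫ x, f x ∂ν| ≤ ν.real J := by
  have hind : ∀ {s : Set K}, MeasurableSet s → Integrable (s.indicator (1 : K → ℝ)) ν :=
    fun hs => (integrable_const (1 : ℝ)).indicator hs
  rw [← integral_indicator_one measurableSet_Iic, ← integral_indicator_one hJ,
    ← integral_sub (hind measurableSet_Iic) (integrable_continuousMap f ν)]
  exact abs_integral_le_integral_abs.trans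
    (integral_mono ((hind measurableSet_Iic).sub (integrable_continuousMap f ν)).abs (hind hJ) h)

theorem abs_apply_Iic_sub_signedIntegral_le (μ : SignedMeasure K) (f : C(K, ℝ))
    {t : K} {J : Set K} (hJ : MeasurableSet J)
    (h : ∀ x, |(Iic t).indicator (1 : K → ℝ) x - f x| ≤ J.indicator (1 : K → ℝ) x) :
    |μ (Iic t) - signedIntegral μ f| ≤ μ.totalVariation.real J := by
  rw [SignedMeasure.apply_eq_posPart_real_sub_negPart_real μ measurableSet_Iic, signedIntegral,
    SignedMeasure.totalVariation, measureReal_add_apply]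
  have h1 := abs_measureReal_Iic_sub_integral_le μ.toJordanDecomposition.posPart f hJ h
  have h2 := abs_measureReal_Iic_sub_integral_le μ.toJordanDecomposition.negPart f hJ h
  rw [abs_le] at *
  constructor <;> linarith

/-- By regularity the two sets of the Hahn decomposition are exhausted by compact sets up to ε/4. A
Urysohn function with values 1 and -1 on these compact sets nearly realizes the variation: the error
is at most twice ε/4 for each of the two parts. -/
theorem totalVariation_real_univ_le (μ : SignedMeasure K) (hμ : μ.totalVariation.Regular) {C : ℝ}
    (h : ∀ f : C(K, ℝ), ‖f‖ ≤ 1 → |signedIntegral μ f| ≤ C) :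
    μ.totalVariation.real univ ≤ C := by
  have : IsFiniteMeasure μ.totalVariation := by
    unfold SignedMeasure.totalVariation; infer_instance
  refine le_of_forall_pos_le_add fun ε hε => ?_
  obtain ⟨S, hS, hpos, hneg⟩ := μ.toJordanDecomposition.mutuallySingular
  have hε' : ENNReal.ofReal (ε / 4) ≠ 0 := by simpa using by linarith
  obtain ⟨K₁, hK₁S, hK₁, hνK₁⟩ := hS.compl.exists_isCompact_sdiff_lt (μ := μ.totalVariation)
    (measure_ne_top _ _) hε'
  obtain ⟨K₂, hK₂S, hK₂, hνK₂⟩ := hS.exists_isCompact_sdiff_lt (μ := μ.totalVariation)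
    (measure_ne_top _ _) hε'
  have hdisj : Disjoint K₂ K₁ := Disjoint.mono hK₂S hK₁S disjoint_compl_right
  obtain ⟨g, hg0, hg1, hg⟩ := exists_continuous_zero_one_of_isClosed hK₂.isClosed hK₁.isClosed hdisj
  let f : C(K, ℝ) := g + g - 1
  have hf : ∀ x, f x = 2 * g x - 1 := fun x => by simp [f]; ring
  have hf1 : ∀ x, |f x| ≤ 1 := fun x => by
    have := hg x
    rw [hf, abs_le]
    constructor <;> linarith [this.1, this.2]
  have hnorm : ‖f‖ ≤ 1 := (ContinuousMap.norm_le _ zero_le_one).2 hf1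
  have hle : ∀ (ν : Measure K), ν ≤ μ.totalVariation → ∀ A B L : Set K, ν A = 0 →
      Aᶜ = B → μ.totalVariation (B \ L) < ENNReal.ofReal (ε / 4) → ν.real Lᶜ ≤ ε / 4 := by
    intro ν hν A B L hA hB hL
    refine ENNReal.toReal_le_of_le_ofReal (by linarith) ?_
    calc ν Lᶜ ≤ ν (A ∪ B \ L) := by
          refine measure_mono fun x hx => ?_
          by_cases hxA : x ∈ A
          · exact .inl hxA
          · exact .inr ⟨hB ▸ hxA, hx⟩
      _ ≤ ν A + ν (B \ L) := measure_union_le _ _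
      _ ≤ 0 + μ.totalVariation (B \ L) := add_le_add hA.le (hν _)
      _ ≤ ENNReal.ofReal (ε / 4) := by rw [zero_add]; exact hL.le
  have hp : μ.toJordanDecomposition.posPart.real K₁ᶜ ≤ ε / 4 :=
    hle _ (Measure.le_add_right le_rfl) S Sᶜ K₁ hpos rfl hνK₁
  have hn : μ.toJordanDecomposition.negPart.real K₂ᶜ ≤ ε / 4 :=
    hle _ (Measure.le_add_left le_rfl) Sᶜ S K₂ hneg (compl_compl S) hνK₂
  have hint : ∀ (ν : Measure K) [IsFiniteMeasure ν] (L : Set K), MeasurableSet L → ∀ u : C(K, ℝ),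
      (∀ x ∈ L, u x = 1) → (∀ x, -1 ≤ u x) →
      ν.real univ ≤ ∫ x, u x ∂ν + 2 * ν.real Lᶜ := by
    intro ν _ L hL u hu1 hu2
    have hi : Integrable (Lᶜ.indicator (1 : K → ℝ)) ν :=
      (integrable_const (1 : ℝ)).indicator hL.compl
    have h1 : ∫ x, (1 : ℝ) ∂ν ≤ ∫ x, (u x + 2 * Lᶜ.indicator (1 : K → ℝ) x) ∂ν := by
      refine integral_mono (integrable_const _)
        ((integrable_continuousMap u ν).add (hi.const_mul 2)) fun x => ?_
      by_cases hx : x ∈ L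
      · simp [hx, hu1 x hx]
      · have := hu2 x
        simp only [mem_compl_iff, hx, not_false_eq_true, indicator_of_mem, Pi.one_apply]
        linarith
    rw [integral_add (integrable_continuousMap u ν) (hi.const_mul 2), integral_const_mul,
      integral_indicator_one hL.compl] at h1
    simpa using h1
  have h1 := hint μ.toJordanDecomposition.posPart K₁ hK₁.measurableSet f
    (fun x hx => by rw [hf, hg1 hx]; norm_num) (fun x => (abs_le.1 (hf1 x)).1)
  have h2 := hint μ.toJordanDecomposition.negPart K₂ hK₂.measurableSet (-f)
    (fun x hx => by rw [ContinuousMap.neg_apply, hf, hg0 hx]; norm_num)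
    (fun x => neg_le_neg (abs_le.1 (hf1 x)).2)
  simp only [ContinuousMap.neg_apply, integral_neg] at h2
  have h3 := (abs_le.1 (h f hnorm)).2
  rw [signedIntegral] at h3
  rw [SignedMeasure.totalVariation, measureReal_add_apply]
  linarith

theorem abs_signedIntegral_le (μ : SignedMeasure K) (f : C(K, ℝ)) :
    |signedIntegral μ f| ≤ (μ.toJordanDecomposition.posPart.real univ +
      μ.toJordanDecomposition.negPart.real univ) * ‖f‖ := by
  have h : ∀ (ν : Measure K) [IsFiniteMeasure ν], |∫ x, f x ∂ν| ≤ ν.real univ * ‖f‖ := by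
    intro ν _
    rw [mul_comm]
    exact norm_integral_le_of_norm_le_const (.of_forall f.norm_coe_le_norm)
  rw [signedIntegral, add_mul]
  exact (abs_sub _ _).trans (add_le_add (h _) (h _))

/-- Integration against a finite signed measure as a continuous linear functional. -/
noncomputable def signedIntegralCLM (μ : SignedMeasure K) : C(K, ℝ) →L[ℝ] ℝ :=
  LinearMap.mkContinuous
    { toFun := fun f => signedIntegral μ f
      map_add' := fun f g => by
        simp only [signedIntegral, ContinuousMap.add_apply]
        rw [integral_add (integrable_continuousMap f _) (integrable_continuousMap g _),
          integral_add (integrable_continuousMap f _) (integrable_continuousMap g _)]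
        ring
      map_smul' := fun c f => by
        simp only [signedIntegral, ContinuousMap.smul_apply, RingHom.id_apply,
          smul_eq_mul]
        rw [integral_const_mul, integral_const_mul]
        ring }
    (μ.toJordanDecomposition.posPart.real univ + μ.toJordanDecomposition.negPart.real univ)
    (abs_signedIntegral_le μ)

theorem exists_bound_totalVariation {I : Type v} (μ : I → SignedMeasure K)
    (hreg : ∀ i, (μ i).totalVariation.Regular)
    (hnull : ∀ f : C(K, ℝ), InC0 fun i => signedIntegral (μ i) f) :
    ∃ M : ℝ, ∀ i, (μ i).totalVariation.real univ ≤ M := by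
  obtain ⟨M, hM⟩ := banach_steinhaus (g := fun i => signedIntegralCLM (μ i)) (by
    intro f
    have h1 : {i | ¬ ‖signedIntegral (μ i) f‖ < 1}.Finite :=
      ((tendsto_norm_zero.comp (hnull f)).eventually_lt_const zero_lt_one)
    obtain ⟨C, hC⟩ := (h1.image fun i => ‖signedIntegral (μ i) f‖).bddAbove
    refine ⟨max C 1, fun i => ?_⟩
    by_cases hi : ‖signedIntegral (μ i) f‖ < 1
    · exact hi.le.trans (le_max_right _ _)
    · exact (hC ⟨i, hi, rfl⟩).trans (le_max_left _ _))
  refine ⟨M, fun i => totalVariation_real_univ_le _ (hreg i) fun f hf => ?_⟩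
  have h1 := (signedIntegralCLM (μ i)).le_of_opNorm_le (hM i) f
  have h0 : 0 ≤ M := (norm_nonneg _).trans (hM i)
  exact h1.trans (mul_le_of_le_one_right h0 hf)

theorem exists_continuousMap_of_lt {t s : K} (h : t < s) :
    ∃ f : C(K, ℝ), (∀ x ≤ t, f x = 1) ∧ (∀ x, s ≤ x → f x = 0) ∧ ∀ x, f x ∈ Icc (0 : ℝ) 1 := by
  obtain ⟨f, h0, h1, hf⟩ := exists_continuous_zero_one_of_isClosed (isClosed_Ici (a := s))
    (isClosed_Iic (a := t))
    (disjoint_left.2 fun x hx hx' => (h.trans_le (mem_Ici.1 hx)).not_ge hx')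
  exact ⟨f, fun x hx => h1 hx, fun x hx => h0 hx, hf⟩

theorem abs_indicator_Iic_sub_le_Ioo {t s : K} {f : C(K, ℝ)} (h1 : ∀ x ≤ t, f x = 1)
    (h0 : ∀ x, s ≤ x → f x = 0) (hf : ∀ x, f x ∈ Icc (0 : ℝ) 1) (x : K) :
    |(Iic t).indicator (1 : K → ℝ) x - f x| ≤ (Ioo t s).indicator (1 : K → ℝ) x := by
  by_cases hx : x ≤ t
  · rw [indicator_of_mem (mem_Iic.2 hx), h1 x hx]
    simp [hx.not_gt]
  · rw [indicator_of_notMem (by simpa using hx)]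
    by_cases hxs : s ≤ x
    · simp [h0 x hxs, hxs.not_gt]
    · rw [indicator_of_mem (show x ∈ Ioo t s from ⟨not_le.1 hx, not_le.1 hxs⟩), Pi.one_apply, zero_sub, abs_neg,
        abs_of_nonneg (hf x).1]
      exact (hf x).2

theorem abs_indicator_Iic_sub_le_Ioc {t s : K} {f : C(K, ℝ)} (h1 : ∀ x ≤ s, f x = 1)
    (h0 : ∀ x, t ≤ x → f x = 0) (hf : ∀ x, f x ∈ Icc (0 : ℝ) 1) (x : K) :
    |(Iic t).indicator (1 : K → ℝ) x - f x| ≤ (Ioc s t).indicator (1 : K → ℝ) x := by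
  have := hf x
  by_cases hx : x ≤ t
  · rw [indicator_of_mem (mem_Iic.2 hx), Pi.one_apply]
    by_cases hxs : x ≤ s
    · simp [h1 x hxs, hxs.not_gt]
    · rw [indicator_of_mem (show x ∈ Ioc s t from ⟨not_le.1 hxs, hx⟩), Pi.one_apply, abs_of_nonneg (by linarith [this.2])]
      linarith [this.1]
  · rw [indicator_of_notMem (by simpa using hx), h0 x (not_le.1 hx).le]
    simp [hx]

end Measure

/-! ### Weak*-null families: disjoint intervals, local behaviour, countable unions -/

section Family

set_option linter.unusedSectionVars false

variable {K : Type u} [LinearOrder K] [TopologicalSpace K] [OrderTopology K]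
    [CompactSpace K] [MeasurableSpace K] [BorelSpace K] {I : Type v}

/-- The regular measures `μ i` represent the maps `F i`, form a weak*-null family, and have total
variation at most `M`. -/
structure IsBoundedNullRepresentation (F : I → K → ℝ) (μ : I → SignedMeasure K) (M : ℝ) :
    Prop where
  represents : ∀ i, Represents (μ i) (F i)
  null : ∀ f : C(K, ℝ), InC0 fun i => signedIntegral (μ i) f
  bound : ∀ i, (μ i).totalVariation.real univ ≤ M

theorem IsWeakStarNull.exists_representation {F : I → K → ℝ} (hF : IsWeakStarNull F) :
    ∃ μ M, IsBoundedNullRepresentation F μ M := by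
  obtain ⟨-, μ, hμ, hnull⟩ := hF
  obtain ⟨M, hM⟩ := exists_bound_totalVariation μ (fun i => (hμ i).1) hnull
  exact ⟨μ, M, hμ, hnull, hM⟩

variable {F : I → K → ℝ} {S T : Set K}

theorem IsTypeC0L1Over.mono (h : IsTypeC0L1Over F T) (hST : S ⊆ T) : IsTypeC0L1Over F S := by
  obtain ⟨a, b, hab, ha, hb⟩ := h
  refine ⟨fun i t => a i ⟨t, hST t.2⟩, fun i t => b i ⟨t, hST t.2⟩, fun i t => hab i ⟨t, hST t.2⟩,
    fun t => ha ⟨t, hST t.2⟩, lt_of_le_of_lt (iSup_mono fun i => ?_) hb⟩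
  exact ENNReal.tsum_comp_le_tsum_of_injective (inclusion_injective hST)
    fun t => ENNReal.ofReal |b i t|

theorem isTypeC0L1Over_of_inC0 (h : ∀ t ∈ S, InC0 fun i => F i t) : IsTypeC0L1Over F S :=
  ⟨fun i t => F i t, fun _ _ => 0, fun i t => by simp, fun t => h t t.2, by simp⟩

instance (μ : SignedMeasure K) : IsFiniteMeasure μ.totalVariation := by
  unfold SignedMeasure.totalVariation; infer_instance

variable {μ : I → SignedMeasure K} {M : ℝ}

namespace IsBoundedNullRepresentation

variable (h : IsBoundedNullRepresentation F μ M)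

include h

theorem abs_sub_le {f : C(K, ℝ)} {t : K} {J : Set K} (hJ : MeasurableSet J)
    (hf : ∀ x, |(Iic t).indicator (1 : K → ℝ) x - f x| ≤ J.indicator (1 : K → ℝ) x) (i : I) :
    |F i t - signedIntegral (μ i) f| ≤ (μ i).totalVariation.real J := by
  rw [(h.represents i).2 t]
  exact abs_apply_Iic_sub_signedIntegral_le _ _ hJ hf

/-- The integrals of `f t` form the c₀ part; the errors are dominated by the variation of disjoint
sets. The bound `M` does not depend on `S`, which `eventually_sum_le` needs. -/
theorem exists_decomposition (f : K → C(K, ℝ)) (J : K → Set K)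
    (hJ : ∀ t ∈ S, MeasurableSet (J t))
    (hf : ∀ t ∈ S, ∀ x,
      |(Iic t).indicator (1 : K → ℝ) x - f t x| ≤ (J t).indicator (1 : K → ℝ) x)
    (hdisj : S.PairwiseDisjoint J) :
    ∃ a b : I → S → ℝ, (∀ i (t : S), F i t = a i t + b i t) ∧ (∀ t, InC0 fun i => a i t) ∧
      ∀ i, ∑' t, ENNReal.ofReal |b i t| ≤ ENNReal.ofReal M := by
  refine ⟨fun i t => signedIntegral (μ i) (f t), fun i t => F i t - signedIntegral (μ i) (f t),
    fun i t => by ring, fun t => h.null _, fun i => ?_⟩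
  calc ∑' t : S, ENNReal.ofReal |F i t - signedIntegral (μ i) (f t)|
      ≤ ∑' t : S, (μ i).totalVariation (J t) := by
        refine ENNReal.tsum_le_tsum fun t => ?_
        refine ENNReal.ofReal_le_of_le_toReal ?_
        exact h.abs_sub_le (hJ t t.2) (hf t t.2) i
    _ ≤ (μ i).totalVariation (⋃ t : S, J t) :=
        tsum_meas_le_meas_iUnion_of_disjoint _ (fun t => hJ t t.2)
          fun s t hst => hdisj s.2 t.2 fun h => hst (Subtype.ext h)
    _ ≤ (μ i).totalVariation univ := measure_mono (subset_univ _)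
    _ ≤ ENNReal.ofReal M := by
        rw [← ENNReal.ofReal_toReal (measure_ne_top (μ i).totalVariation univ)]
        exact ENNReal.ofReal_le_ofReal (h.bound i)

theorem isTypeC0L1Over_of_pairwiseDisjoint (f : K → C(K, ℝ)) (J : K → Set K)
    (hJ : ∀ t ∈ S, MeasurableSet (J t))
    (hf : ∀ t ∈ S, ∀ x,
      |(Iic t).indicator (1 : K → ℝ) x - f t x| ≤ (J t).indicator (1 : K → ℝ) x)
    (hdisj : S.PairwiseDisjoint J) : IsTypeC0L1Over F S := by
  obtain ⟨a, b, hab, ha, hb⟩ := h.exists_decomposition f J hJ hf hdisj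
  exact ⟨a, b, hab, ha, lt_of_le_of_lt (iSup_le hb) ENNReal.ofReal_lt_top⟩

theorem isTypeC0L1Over_of_Ioo (s : K → K) (hs : ∀ t ∈ S, t < s t)
    (hS : ∀ t ∈ S, ∀ t' ∈ S, t < t' → s t ≤ t') : IsTypeC0L1Over F S := by
  have hex : ∀ t, ∃ f : C(K, ℝ), t ∈ S → ∀ x,
      |(Iic t).indicator (1 : K → ℝ) x - f x| ≤ (Ioo t (s t)).indicator (1 : K → ℝ) x := by
    intro t
    by_cases ht : t ∈ S
    · obtain ⟨f, h1, h0, hf⟩ := exists_continuousMap_of_lt (hs t ht)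
      exact ⟨f, fun _ => abs_indicator_Iic_sub_le_Ioo h1 h0 hf⟩
    · exact ⟨0, fun h => (ht h).elim⟩
  choose f hf using hex
  refine h.isTypeC0L1Over_of_pairwiseDisjoint f (fun t => Ioo t (s t))
    (fun t _ => measurableSet_Ioo) hf ?_
  have key : ∀ t ∈ S, ∀ t' ∈ S, t < t' → Disjoint (Ioo t (s t)) (Ioo t' (s t')) :=
    fun t ht t' ht' htt' => disjoint_left.2 fun x hx hx' =>
      ((hx.2.trans_le (hS t ht t' ht' htt')).trans hx'.1).false
  intro t ht t' ht' hne
  rcases lt_or_gt_of_ne hne with hlt | hlt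
  · exact key t ht t' ht' hlt
  · exact (key t' ht' t ht hlt).symm

theorem isTypeC0L1Over_of_Ioc (s : K → K) (hs : ∀ t ∈ S, s t < t)
    (hS : ∀ t ∈ S, ∀ t' ∈ S, t < t' → t ≤ s t') : IsTypeC0L1Over F S := by
  have hex : ∀ t, ∃ f : C(K, ℝ), t ∈ S → ∀ x,
      |(Iic t).indicator (1 : K → ℝ) x - f x| ≤ (Ioc (s t) t).indicator (1 : K → ℝ) x := by
    intro t
    by_cases ht : t ∈ S
    · obtain ⟨f, h1, h0, hf⟩ := exists_continuousMap_of_lt (hs t ht)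
      exact ⟨f, fun _ => abs_indicator_Iic_sub_le_Ioc h1 h0 hf⟩
    · exact ⟨0, fun h => (ht h).elim⟩
  choose f hf using hex
  refine h.isTypeC0L1Over_of_pairwiseDisjoint f (fun t => Ioc (s t) t)
    (fun t _ => measurableSet_Ioc) hf ?_
  have key : ∀ t ∈ S, ∀ t' ∈ S, t < t' → Disjoint (Ioc (s t) t) (Ioc (s t') t') :=
    fun t ht t' ht' htt' => disjoint_left.2 fun x hx hx' =>
      (hx'.1.trans_le (hx.2.trans (hS t ht t' ht' htt'))).false
  intro t ht t' ht' hne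
  rcases lt_or_gt_of_ne hne with hlt | hlt
  · exact key t ht t' ht' hlt
  · exact (key t' ht' t ht hlt).symm

/-- Over finite sets the family is eventually bounded in `ℓ₁`-norm by a common constant. -/
theorem eventually_sum_le (T : Finset K) : ∀ᶠ i in cofinite, ∑ t ∈ T, |F i t| ≤ max M 0 + 1 := by
  have hex : ∀ t, ∃ f : C(K, ℝ), ∃ J : Set K, MeasurableSet J ∧
      (∀ x, |(Iic t).indicator (1 : K → ℝ) x - f x| ≤ J.indicator (1 : K → ℝ) x) ∧
      J ⊆ Ioi t ∧ ∀ t' ∈ T, t < t' → J ⊆ Iio t' := by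
    intro t
    by_cases ht : IsTop t
    · refine ⟨1, ∅, .empty, fun x => ?_, empty_subset _, fun _ _ _ => empty_subset _⟩
      simp [indicator_of_mem (mem_Iic.2 (ht x))]
    · obtain ⟨s, hs, hsT⟩ : ∃ s, t < s ∧ ∀ t' ∈ T, t < t' → s ≤ t' := by
        rcases (T.filter (t < ·)).eq_empty_or_nonempty with h0 | h0
        · obtain ⟨s, hs⟩ := not_forall.1 ht
          exact ⟨s, not_le.1 hs, fun t' h1 h2 =>
            (Finset.notMem_empty t' (h0 ▸ Finset.mem_filter.2 ⟨h1, h2⟩)).elim⟩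
        · exact ⟨_, (Finset.mem_filter.1 (Finset.min'_mem _ h0)).2,
            fun t' h1 h2 => Finset.min'_le _ _ (Finset.mem_filter.2 ⟨h1, h2⟩)⟩
      obtain ⟨f, h1, h0, hf⟩ := exists_continuousMap_of_lt hs
      exact ⟨f, Ioo t s, measurableSet_Ioo, abs_indicator_Iic_sub_le_Ioo h1 h0 hf,
        fun x hx => hx.1, fun t' h2 h3 x hx => hx.2.trans_le (hsT t' h2 h3)⟩
  choose f J hJ hf hJt hJT using hex
  have key : ∀ t ∈ T, ∀ t' ∈ T, t < t' → Disjoint (J t) (J t') :=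
    fun t _ t' ht' htt' => disjoint_left.2 fun x hx hx' =>
      (lt_trans (mem_Iio.1 (hJT t t' ht' htt' hx)) (mem_Ioi.1 (hJt t' hx'))).false
  obtain ⟨a, b, hab, ha, hb⟩ := h.exists_decomposition (S := (T : Set K)) f J (fun t _ => hJ t)
    (fun t _ => hf t) (by
      intro t ht t' ht' hne
      rcases lt_or_gt_of_ne hne with hlt | hlt
      · exact key t ht t' ht' hlt
      · exact (key t' ht' t ht hlt).symm)
  -- Over a finite set the c₀ part has ℓ₁-norm tending to 0; the summand 1 in the bound absorbs it.
  have hlim : Tendsto (fun i => ∑ t : (T : Set K), |a i t|) cofinite (𝓝 0) := by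
    have := tendsto_finsetSum (Finset.univ : Finset (T : Set K)) fun t _ => (ha t).abs
    simpa using this
  filter_upwards [hlim.eventually_lt_const zero_lt_one] with i hi
  have hbi : ∑ t : (T : Set K), |b i t| ≤ max M 0 := by
    have h1 := hb i
    rw [tsum_fintype, ← ENNReal.ofReal_sum_of_nonneg fun _ _ => abs_nonneg _] at h1
    exact (ENNReal.ofReal_le_ofReal_iff (le_max_right _ _)).1
      (h1.trans (ENNReal.ofReal_le_ofReal (le_max_left _ _)))
  have hsum : ∑ t ∈ T, |F i t| = ∑ t : (T : Set K), |F i t| :=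
    (Finset.sum_coe_sort T fun t => |F i t|).symm
  rw [hsum]
  calc ∑ t : (T : Set K), |F i t| ≤ ∑ t : (T : Set K), (|a i t| + |b i t|) :=
        Finset.sum_le_sum fun t _ => by rw [hab]; exact abs_add_le (a i t) (b i t)
    _ = ∑ t : (T : Set K), |a i t| + ∑ t : (T : Set K), |b i t| := Finset.sum_add_distrib
    _ ≤ max M 0 + 1 := by linarith

/-- Outer regularity of the variation at the closed half-line up to `t`; no countability of the
character is needed. -/
theorem exists_gt_totalVariation_lt {t : K} (ht : ∃ s, t < s) (i : I) {ε : ℝ} (hε : 0 < ε) :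
    ∃ s, t < s ∧ ∀ s' ≤ s, (μ i).totalVariation.real (Ioo t s') < ε := by
  have := (h.represents i).1
  obtain ⟨U, hU, hUo, -, hUε⟩ := (measurableSet_Iic (a := t)).exists_isOpen_sdiff_lt
    (μ := (μ i).totalVariation) (measure_ne_top _ _) (ε := ENNReal.ofReal ε) (by simpa using hε)
  obtain ⟨s, hs, hsU⟩ := exists_Ico_subset_of_mem_nhds (hUo.mem_nhds (hU self_mem_Iic)) ht
  refine ⟨s, hs, fun s' hs' => ?_⟩
  refine (ENNReal.toReal_lt_toReal (measure_ne_top _ _) ENNReal.ofReal_ne_top).2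
    ((measure_mono ?_).trans_lt hUε) |>.trans_eq (ENNReal.toReal_ofReal hε.le)
  exact fun x hx => ⟨hsU ⟨hx.1.le, hx.2.trans_le hs'⟩, not_le.2 hx.1⟩

theorem exists_signedIntegral_of_lt {t s : K} (hts : t < s) :
    ∃ f : C(K, ℝ), ∀ i,
      |F i t - signedIntegral (μ i) f| ≤ (μ i).totalVariation.real (Ioo t s) := by
  obtain ⟨f, h1, h0, hf⟩ := exists_continuousMap_of_lt hts
  exact ⟨f, h.abs_sub_le measurableSet_Ioo (abs_indicator_Iic_sub_le_Ioo h1 h0 hf)⟩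

theorem inC0_of_isTop {t : K} (ht : IsTop t) : InC0 fun i => F i t := by
  have h0 : (fun i => F i t) = fun i => signedIntegral (μ i) (1 : C(K, ℝ)) := by
    funext i
    have := h.abs_sub_le (f := 1) (t := t) MeasurableSet.empty (fun x => by
      simp [indicator_of_mem (mem_Iic.2 (ht x))]) i
    rw [measureReal_empty] at this
    exact sub_eq_zero.1 (abs_nonpos_iff.1 this)
  rw [h0]
  exact h.null 1

/-- The integrals of the functions attached to points s of `A` approximate F_i(t) as s approaches
`t`. If F_i(t) ≠ 0, one of these countably many integrals is nonzero, and each is nonzero for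
countably many `i` only. -/
theorem countable_support_of_isGLB {t : K} {A : Set K} (hA : A.Countable) (hAt : A ⊆ Ioi t)
    (hglb : IsGLB A t) (htop : ∃ s, t < s) : {i | F i t ≠ 0}.Countable := by
  have hex : ∀ s, ∃ f : C(K, ℝ), s ∈ A → ∀ i,
      |F i t - signedIntegral (μ i) f| ≤ (μ i).totalVariation.real (Ioo t s) := by
    intro s
    by_cases hs : s ∈ A
    · obtain ⟨f, hf⟩ := h.exists_signedIntegral_of_lt (hAt hs)
      exact ⟨f, fun _ => hf⟩
    · exact ⟨0, fun h => (hs h).elim⟩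
  choose f hf using hex
  refine (hA.biUnion fun s _ => (h.null (f s)).countable_support).mono ?_
  intro i hi
  by_contra hcon
  refine hi (abs_nonpos_iff.1 (le_of_forall_pos_lt_add fun ε hε => ?_))
  obtain ⟨s, hs, hsε⟩ := h.exists_gt_totalVariation_lt htop i hε
  obtain ⟨s', hs'A, -, hs's⟩ := hglb.exists_between hs
  have h0 : signedIntegral (μ i) (f s') = 0 := by
    by_contra h1
    exact hcon (mem_biUnion hs'A h1)
  have := hf s' hs'A i
  rw [h0, sub_zero] at this
  rw [zero_add]
  exact this.trans_lt (hsε s' hs's.le)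

/-- For countably many indices, the right neighbourhoods on which the variations are below 1/(n+1)
have a common lower bound r > t. Hence all these variations vanish on ]t,r[, and a single continuous
function gives F_i(t) exactly. -/
theorem inC0_of_forall_not_isGLB {t : K} (htop : ∃ s, t < s)
    (ht : ∀ A : Set K, A.Countable → A ⊆ Ioi t → ¬ IsGLB A t) : InC0 fun i => F i t := by
  have hev : ∀ ε > 0, {i | ε ≤ |F i t|}.Finite := by
    intro ε hε
    by_contra hinf
    obtain ⟨N, hN, hNinf, hNc⟩ : ∃ N ⊆ {i | ε ≤ |F i t|}, N.Infinite ∧ N.Countable := by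
      have e := Set.Infinite.natEmbedding _ hinf
      refine ⟨range fun n => (e n : I), ?_, infinite_range_of_injective
        (Subtype.val_injective.comp e.injective), countable_range _⟩
      rintro _ ⟨n, rfl⟩
      exact (e n).2
    have hex : ∀ i, ∀ n : ℕ, ∃ s, t < s ∧
        ∀ s' ≤ s, (μ i).totalVariation.real (Ioo t s') < 1 / ((n : ℝ) + 1) :=
      fun i n => h.exists_gt_totalVariation_lt htop i Nat.one_div_pos_of_nat
    choose s hs hsn using hex
    let A : Set K := ⋃ i ∈ N, range (s i)
    have hA : A ⊆ Ioi t := by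
      intro x hx
      obtain ⟨i, -, n, rfl⟩ := mem_iUnion₂.1 hx
      exact hs i n
    have h1 := ht A (hNc.biUnion fun i _ => countable_range _) hA
    obtain ⟨r, hr, htr⟩ : ∃ r ∈ lowerBounds A, t < r := by
      by_contra hcon
      push Not at hcon
      exact h1 ⟨fun x hx => (hA hx).le, hcon⟩
    obtain ⟨f, hf⟩ := h.exists_signedIntegral_of_lt htr
    have h2 : ∀ i ∈ N, F i t = signedIntegral (μ i) f := by
      intro i hi
      refine sub_eq_zero.1 (abs_nonpos_iff.1 (le_of_forall_pos_lt_add fun δ hδ => ?_))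
      obtain ⟨n, hn⟩ := exists_nat_one_div_lt hδ
      rw [zero_add]
      exact (hf i).trans_lt ((hsn i n r (hr (mem_biUnion hi (mem_range_self n)))).trans hn)
    have h3 : {i | ¬ |signedIntegral (μ i) f| < ε}.Finite := by
      have := (h.null f).abs
      rw [abs_zero] at this
      exact this.eventually_lt_const hε
    exact hNinf (h3.subset fun i hi => by
      show ¬ _
      rw [← h2 i hi]
      exact not_lt.2 (hN hi))
  rw [InC0, Metric.tendsto_nhds]
  intro ε hε
  refine (hev ε hε).subset fun i hi => ?_
  simpa using hi

theorem countable_support (t : K) : {i | F i t ≠ 0}.Countable := by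
  by_cases htop : ∃ s, t < s
  · by_cases hA : ∃ A : Set K, A.Countable ∧ A ⊆ Ioi t ∧ IsGLB A t
    · obtain ⟨A, hA, hAt, hglb⟩ := hA
      exact h.countable_support_of_isGLB hA hAt hglb htop
    · push Not at hA
      exact (h.inC0_of_forall_not_isGLB htop hA).countable_support
  · push Not at htop
    exact (h.inC0_of_isTop htop).countable_support

theorem rightCharacter_le_of_not_inC0 {t : K} (ht : ¬ InC0 fun i => F i t) :
    rightCharacter t ≤ ℵ₀ := by
  rw [rightCharacter]
  split_ifs
  · exact le_rfl
  by_contra hcon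
  refine ht ?_
  by_cases htop : ∃ s, t < s
  · refine h.inC0_of_forall_not_isGLB htop fun A hA hAt hglb => hcon ?_
    exact (csInf_le' (show #A ∈ {c | ∃ A : Set K, A ⊆ Ioi t ∧ IsGLB A t ∧ #A = c} from
      ⟨A, hAt, hglb, rfl⟩)).trans (mk_le_aleph0_iff.2 hA)
  · push Not at htop
    exact h.inC0_of_isTop htop

theorem isTypeC0L1Over_of_subset_iUnion (A : ℕ → Set K) (hA : ∀ n, IsTypeC0L1Over F (A n))
    (hS : S ⊆ ⋃ n, A n) : IsTypeC0L1Over F S := by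
  refine isTypeC0L1_of_iUnion (C := max M 0 + 1) (fun t => h.countable_support t) (fun T => ?_)
    (fun n => {t : S | (t : K) ∈ A n}) (fun t => (mem_iUnion (s := A)).1 (hS t.2)) fun n => ?_
  · filter_upwards [h.eventually_sum_le (T.map (Function.Embedding.subtype _))] with i hi
    simpa using hi
  · obtain ⟨a, b, hab, ha, hb⟩ := hA n
    let j : {t : S | (t : K) ∈ A n} → A n := fun t => ⟨t.1.1, t.2⟩
    have hj : Function.Injective j := fun x y hxy =>
      Subtype.ext (Subtype.ext (congrArg (fun z : A n => (z : K)) hxy))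
    exact ⟨fun i t => a i (j t), fun i t => b i (j t), fun i t => hab i (j t), fun t => ha (j t),
      lt_of_le_of_lt (iSup_mono fun i =>
        ENNReal.tsum_comp_le_tsum_of_injective hj fun t => ENNReal.ofReal |b i t|) hb⟩

theorem isTypeC0L1Over_of_countable {ι : Type*} [Countable ι] (A : ι → Set K)
    (hA : ∀ n, IsTypeC0L1Over F (A n)) (hS : S ⊆ ⋃ n, A n) : IsTypeC0L1Over F S := by
  obtain ⟨e, he⟩ := exists_injective_nat ι
  refine h.isTypeC0L1Over_of_subset_iUnion (fun n => ⋃ j ∈ {j | e j = n}, A j) (fun n => ?_)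
    fun t ht => ?_
  · by_cases hn : ∃ j, e j = n
    · obtain ⟨j, rfl⟩ := hn
      refine (hA j).mono (iUnion₂_subset fun j' hj' => ?_)
      rw [he hj']
    · refine isTypeC0L1Over_of_inC0 fun t ht => ?_
      obtain ⟨j, hj, -⟩ := mem_iUnion₂.1 ht
      exact (hn ⟨j, hj⟩).elim
  · obtain ⟨j, hj⟩ := mem_iUnion.1 (hS ht)
    exact mem_iUnion.2 ⟨e j, mem_biUnion rfl hj⟩

theorem isTypeC0L1Over_union (hS : IsTypeC0L1Over F S) (hT : IsTypeC0L1Over F T) :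
    IsTypeC0L1Over F (S ∪ T) :=
  h.isTypeC0L1Over_of_countable (fun b : Bool => bif b then S else T)
    (fun b => by cases b <;> assumption) (by
      rintro t (ht | ht)
      · exact mem_iUnion.2 ⟨true, ht⟩
      · exact mem_iUnion.2 ⟨false, ht⟩)

/-- Numbering every fiber splits `S` into countably many sets on which `φ` is injective. -/
theorem isTypeC0L1Over_of_countable_fibers {ι : Type*} (φ : K → ι)
    (hφ : ∀ j, {t ∈ S | φ t = j}.Countable)
    (hS : ∀ A ⊆ S, InjOn φ A → IsTypeC0L1Over F A) : IsTypeC0L1Over F S := by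
  choose g hg using fun j => countable_iff_exists_injOn.1 (hφ j)
  refine h.isTypeC0L1Over_of_subset_iUnion (fun n => {t ∈ S | g (φ t) t = n}) (fun n => ?_)
    fun t ht => mem_iUnion.2 ⟨_, ht, rfl⟩
  refine hS _ (fun t ht => ht.1) fun t ht t' ht' heq => ?_
  refine hg (φ t) ⟨ht.1, rfl⟩ ⟨ht'.1, heq.symm⟩ ?_
  rw [ht.2]
  rw [heq, ht'.2]

end IsBoundedNullRepresentation

end Family

/-! ### Separable components and the good sets of the cover -/

section Order

set_option linter.unusedSectionVars false

open TopologicalSpace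

/-- Take least elements for a well-ordering unrelated to the order of the line. -/
theorem exists_consistent_choice (α : Type*) [Nonempty α] : ∃ φ : Set α → α,
    (∀ s : Set α, s.Nonempty → φ s ∈ s) ∧ ∀ s s' : Set α, s ⊆ s' → φ s' ∈ s → φ s = φ s' := by
  classical
  have hwf : WellFounded (WellOrderingRel : α → α → Prop) := WellOrderingRel.isWellOrder.wf
  let φ : Set α → α := fun s => if h : s.Nonempty then hwf.min s h else Classical.arbitrary α
  have hφ : ∀ s : Set α, s.Nonempty → φ s ∈ s := by
    intro s hs
    simp only [φ, dif_pos hs]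
    exact hwf.min_mem s hs
  have hmin : ∀ (s : Set α), ∀ x ∈ s, ¬ WellOrderingRel x (φ s) := by
    intro s x hx
    have hs : s.Nonempty := ⟨x, hx⟩
    simp only [φ, dif_pos hs]
    exact hwf.not_lt_min s hx
  refine ⟨φ, hφ, fun s s' hss' hmem => ?_⟩
  rcases trichotomous_of (WellOrderingRel : α → α → Prop) (φ s) (φ s') with h | h | h
  · exact (hmin s' _ (hss' (hφ s ⟨_, hmem⟩)) h).elim
  · exact h
  · exact (hmin s _ hmem h).elim

variable {K : Type u} [LinearOrder K] [TopologicalSpace K] [OrderTopology K]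

/-- The countable set given by `IsSeparable` may lie outside the interval. Its points inside are
dense in the open interval, so adding the endpoints suffices. -/
theorem separableSpace_Icc {a b : K} (h : IsSeparable (Icc a b)) : SeparableSpace (Icc a b) := by
  obtain ⟨D, hD, hsub⟩ := h
  refine ⟨⟨{x : Icc a b | (x : K) ∈ D ∪ {a, b}}, ?_, fun x => ?_⟩⟩
  · exact (hD.union (toFinite {a, b}).countable).preimage Subtype.val_injective
  · rw [mem_closure_iff_nhds]
    intro V hV
    obtain ⟨U, hU, hUV⟩ := mem_nhds_subtype _ _ _ |>.1 hV
    rcases eq_endpoints_or_mem_Ioo_of_mem_Icc x.2 with hx | hx | hx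
    · exact ⟨x, hUV (mem_of_mem_nhds (x := (x : K)) hU), .inr (.inl hx)⟩
    · exact ⟨x, hUV (mem_of_mem_nhds (x := (x : K)) hU), .inr (.inr hx)⟩
    · obtain ⟨y, hy, hyD⟩ := mem_closure_iff_nhds.1 (hsub x.2) (U ∩ Ioo a b)
        (inter_mem hU (Ioo_mem_nhds hx.1 hx.2))
      exact ⟨⟨y, Ioo_subset_Icc_self hy.2⟩, hUV hy.1, .inl hyD⟩

/-- The points joined to `t` by a separable interval. -/
def separableComponent (t : K) : Set K :=
  {u | IsSeparable (uIcc t u)}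

theorem mem_separableComponent_comm {t u : K} :
    u ∈ separableComponent t ↔ t ∈ separableComponent u := by
  simp only [separableComponent, mem_ofPred_eq, uIcc_comm]

theorem self_mem_separableComponent (t : K) : t ∈ separableComponent t := by
  simpa [separableComponent] using (countable_singleton t).isSeparable

theorem separableComponent_eq {t u : K} (h : u ∈ separableComponent t) :
    separableComponent u = separableComponent t := by
  ext v
  constructor
  · intro hv
    exact (IsSeparable.union h hv).mono uIcc_subset_uIcc_union_uIcc
  · intro hv
    exact (IsSeparable.union (mem_separableComponent_comm.1 h) hv).mono
      uIcc_subset_uIcc_union_uIcc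

theorem mem_separableComponent_of_mem_uIcc {t u v : K} (h : u ∈ separableComponent t)
    (hv : v ∈ uIcc t u) : v ∈ separableComponent t :=
  IsSeparable.mono h (uIcc_subset_uIcc_left hv)

theorem HasSeparableAdjacency.exists_ne {t : K} (h : HasSeparableAdjacency t) :
    ∃ u ∈ separableComponent t, u ≠ t := by
  obtain ⟨C, hC, hCn, hCs, htC⟩ := h
  obtain ⟨u, hu, hut⟩ := hCn.exists_ne t
  exact ⟨u, (IsSeparable.of_subtype C).mono (hC.uIcc_subset htC hu), hut⟩

/-- Passing from `K` to [a,b] makes no new point right isolated except `b`, whence the half-open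
interval. -/
theorem countable_inter_Ico_of_isSeparable {Q : Set K} {P : K → Prop}
    (hsep : ∀ H : Set K, IsClosed H → SeparableSpace H →
      {t ∈ Q ∩ (H \ (Subtype.val '' rightIsolated H)) | P t}.Countable)
    {a b : K} (hab : IsSeparable (Icc a b)) :
    ({t ∈ Q | P t ∧ t ∉ rightIsolated K} ∩ Ico a b).Countable := by
  refine (hsep (Icc a b) isClosed_Icc (separableSpace_Icc hab)).mono ?_
  rintro t ⟨⟨htQ, htP, htr⟩, hta, htb⟩
  refine ⟨⟨htQ, ⟨hta, htb.le⟩, ?_⟩, htP⟩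
  rintro ⟨x, hx | ⟨s, hxs, hs⟩, rfl⟩
  · exact (hx ⟨b, hta.trans htb.le, le_rfl⟩).not_gt htb
  · refine htr (.inr ⟨s, hxs, eq_empty_of_forall_notMem fun y hy => ?_⟩)
    have : (⟨y, hta.trans hy.1.le, hy.2.le.trans s.2.2⟩ : Icc a b) ∈ Ioo x s := hy
    rw [hs] at this
    exact this

variable [CompactSpace K] [MeasurableSpace K] [BorelSpace K] {I : Type v} {F : I → K → ℝ}
  {μ : I → SignedMeasure K} {M : ℝ}

namespace IsBoundedNullRepresentation

variable (h : IsBoundedNullRepresentation F μ M)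

include h

theorem inC0_of_mem_rightIsolated {t : K} (ht : t ∈ rightIsolated K) : InC0 fun i => F i t := by
  rcases ht with ht | ⟨s, hts, hs⟩
  · exact h.inC0_of_isTop ht
  · refine h.inC0_of_forall_not_isGLB ⟨s, hts⟩ fun A _ hA hglb => hts.not_ge (hglb.2 fun x hx => ?_)
    by_contra hxs
    exact eq_empty_iff_forall_notMem.1 hs x ⟨hA hx, not_le.1 hxs⟩

theorem isTypeC0L1Over_leftIsolated : IsTypeC0L1Over F (leftIsolated K) := by
  have h1 : IsTypeC0L1Over F {t : K | IsTop t} :=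
    isTypeC0L1Over_of_inC0 fun t ht => h.inC0_of_isTop ht
  have h2 : IsTypeC0L1Over F {t : K | IsBot t ∧ ¬ IsTop t} := by
    have hex : ∀ t : K, ∃ s, ¬ IsTop t → t < s := by
      intro t
      by_cases ht : IsTop t
      · exact ⟨t, fun h => (h ht).elim⟩
      · obtain ⟨s, hs⟩ := not_forall.1 ht
        exact ⟨s, fun _ => not_le.1 hs⟩
    choose s hs using hex
    exact h.isTypeC0L1Over_of_Ioo s (fun t ht => hs t ht.2)
      fun t _ t' ht' htt' => ((ht'.1 t).not_gt htt').elim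
  have h3 : IsTypeC0L1Over F {t : K | ∃ s, s < t ∧ Ioo s t = ∅} := by
    have hex : ∀ t : K, ∃ s, t ∈ {t : K | ∃ s, s < t ∧ Ioo s t = ∅} → s < t ∧ Ioo s t = ∅ := by
      intro t
      by_cases ht : ∃ s, s < t ∧ Ioo s t = ∅
      · exact ⟨ht.choose, fun _ => ht.choose_spec⟩
      · exact ⟨t, fun h => (ht h).elim⟩
    choose s hs using hex
    refine h.isTypeC0L1Over_of_Ioc s (fun t ht => (hs t ht).1) fun t _ t' ht' htt' => ?_
    by_contra hcon
    exact eq_empty_iff_forall_notMem.1 (hs t' ht').2 t ⟨not_le.1 hcon, htt'⟩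
  refine (h.isTypeC0L1Over_union h1 (h.isTypeC0L1Over_union h2 h3)).mono ?_
  rintro t (ht | ht)
  · by_cases htop : IsTop t
    · exact .inl htop
    · exact .inr (.inl ⟨ht, htop⟩)
  · exact .inr (.inr ht)

/-- A point not accumulated by `B` from one side has there an interval free of `B`; for each side
these intervals are pairwise disjoint. -/
theorem isTypeC0L1Over_diff_twoSidedDer (B : Set K) :
    IsTypeC0L1Over F ((B \ twoSidedDer B) \ (rightIsolated K ∪ leftIsolated K)) := by
  let R : Set K := {t ∈ B | ∃ s, t < s ∧ Ioo t s ∩ B = ∅}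
  let L : Set K := {t ∈ B | ∃ s, s < t ∧ Ioo s t ∩ B = ∅}
  have hR : IsTypeC0L1Over F R := by
    have hex : ∀ t : K, ∃ s, t ∈ R → t < s ∧ Ioo t s ∩ B = ∅ := by
      intro t
      by_cases ht : t ∈ R
      · exact ⟨ht.2.choose, fun _ => ht.2.choose_spec⟩
      · exact ⟨t, fun h => (ht h).elim⟩
    choose s hs using hex
    refine h.isTypeC0L1Over_of_Ioo s (fun t ht => (hs t ht).1) fun t ht t' ht' htt' => ?_
    by_contra hcon
    exact eq_empty_iff_forall_notMem.1 (hs t ht).2 t' ⟨⟨htt', not_le.1 hcon⟩, ht'.1⟩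
  have hL : IsTypeC0L1Over F L := by
    have hex : ∀ t : K, ∃ s, t ∈ L → s < t ∧ Ioo s t ∩ B = ∅ := by
      intro t
      by_cases ht : t ∈ L
      · exact ⟨ht.2.choose, fun _ => ht.2.choose_spec⟩
      · exact ⟨t, fun h => (ht h).elim⟩
    choose s hs using hex
    refine h.isTypeC0L1Over_of_Ioc s (fun t ht => (hs t ht).1) fun t ht t' ht' htt' => ?_
    by_contra hcon
    exact eq_empty_iff_forall_notMem.1 (hs t' ht').2 t ⟨⟨not_le.1 hcon, htt'⟩, ht.1⟩
  refine (h.isTypeC0L1Over_union hR hL).mono ?_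
  rintro t ⟨⟨htB, htd⟩, hti⟩
  by_contra hcon
  refine htd ⟨htB, fun hb => hti (.inr (.inl hb)), fun hb => hti (.inl (.inl hb)),
    fun s₁ s₂ h1 h2 => ⟨?_, ?_⟩⟩
  · by_contra hne
    exact hcon (.inr ⟨htB, s₁, h1, not_nonempty_iff_eq_empty.1 hne⟩)
  · by_contra hne
    exact hcon (.inl ⟨htB, s₂, h2, not_nonempty_iff_eq_empty.1 hne⟩)

theorem isTypeC0L1Over_of_finiteTwoSidedHeight {A : Set K} (hA : FiniteTwoSidedHeight A) :
    IsTypeC0L1Over F (A ∩ internalPoints K) := by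
  obtain ⟨n, hn⟩ := hA
  have key : ∀ n, IsTypeC0L1Over F ((A \ iterDer n A) ∩ internalPoints K) := by
    intro n
    induction n with
    | zero => exact isTypeC0L1Over_of_inC0 fun t ht => (ht.1.2 ht.1.1).elim
    | succ n ih =>
      refine (h.isTypeC0L1Over_union ih (h.isTypeC0L1Over_diff_twoSidedDer (iterDer n A))).mono ?_
      rintro t ⟨⟨htA, htn⟩, hti⟩
      by_cases ht : t ∈ iterDer n A
      · exact .inr ⟨⟨ht, htn⟩, hti⟩
      · exact .inl ⟨⟨htA, ht⟩, hti⟩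
  refine (key n).mono ?_
  rw [hn, sdiff_empty]

/-- A separable component need not be separable as a whole, so each gets a base point φ(E t). Points
above it are joined to a chosen larger point of the component, points below it to a chosen smaller
one; the ends of components are treated apart. -/
theorem isTypeC0L1Over_of_hasSeparableAdjacency {X : Set K}
    (hX : ∀ a b : K, IsSeparable (Icc a b) → (X ∩ Ico a b).Countable)
    (hadj : ∀ t ∈ X, HasSeparableAdjacency t) : IsTypeC0L1Over F X := by
  rcases isEmpty_or_nonempty K with hK | hK
  · exact isTypeC0L1Over_of_inC0 fun t _ => hK.elim t
  obtain ⟨φ, hφ, hφc⟩ := exists_consistent_choice K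
  let E : K → Set K := separableComponent
  have hbase : ∀ t, φ (E t) ∈ E t := fun t => hφ _ ⟨t, self_mem_separableComponent t⟩
  let r : K → K := fun t => φ (E t ∩ Ioi t)
  let l : K → K := fun t => φ (E t ∩ Iio t)
  have hr : ∀ {t}, (∃ u ∈ E t, t < u) → r t ∈ E t ∩ Ioi t := fun ⟨u, hu, htu⟩ => hφ _ ⟨u, hu, htu⟩
  have hl : ∀ {t}, (∃ u ∈ E t, u < t) → l t ∈ E t ∩ Iio t := fun ⟨u, hu, htu⟩ => hφ _ ⟨u, hu, htu⟩
  have hmem_gt : ∀ {t u v}, u ∈ E t → t < v → v < u → v ∈ E t := fun hu htv hvu =>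
    mem_separableComponent_of_mem_uIcc hu (mem_uIcc_of_le htv.le hvu.le)
  have hmem_lt : ∀ {t u v}, u ∈ E t → u < v → v < t → v ∈ E t := fun hu huv hvt =>
    mem_separableComponent_of_mem_uIcc hu (mem_uIcc_of_ge huv.le hvt.le)
  have hUp : IsTypeC0L1Over F {t ∈ X | φ (E t) ≤ t ∧ ∃ u ∈ E t, t < u} := by
    refine h.isTypeC0L1Over_of_countable_fibers r (fun w => ?_) fun A hA hinj => ?_
    -- The fiber of `r` over `w` lies between the base point and `w`, in a separable interval, so it
    -- is countable.
    · by_cases hw : φ (E w) ≤ w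
      · refine (hX (φ (E w)) w (by
          have : IsSeparable (uIcc (φ (E w)) w) := mem_separableComponent_comm.1 (hbase w)
          rwa [uIcc_of_le hw] at this)).mono ?_
        rintro t ⟨⟨htX, hte, htu⟩, rfl⟩
        refine ⟨htX, ?_, (hr htu).2⟩
        rwa [show E (r t) = E t from separableComponent_eq (hr htu).1]
      · refine countable_empty.mono ?_
        rintro t ⟨⟨htX, hte, htu⟩, rfl⟩
        rw [show E (r t) = E t from separableComponent_eq (hr htu).1] at hw
        exact hw (hte.trans (hr htu).2.le)
    · refine h.isTypeC0L1Over_of_Ioo r (fun t ht => (hr (hA ht).2.2).2) fun t ht t' ht' htt' => ?_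
      by_contra hcon
      rw [not_le] at hcon
      have ht'E : t' ∈ E t := hmem_gt (hr (hA ht).2.2).1 htt' hcon
      have hEE : E t' = E t := separableComponent_eq ht'E
      -- If t < t' < r t, then `r t` is still available to t', so consistency of the choice gives r
      -- t' = r t, against injectivity.
      refine htt'.ne' (hinj ht' ht (hφc _ _ ?_ ⟨?_, hcon⟩))
      · rw [hEE]
        exact inter_subset_inter_right _ (Ioi_subset_Ioi htt'.le)
      · rw [hEE]
        exact (hr (hA ht).2.2).1
  have hDown : IsTypeC0L1Over F {t ∈ X | t < φ (E t) ∧ ∃ u ∈ E t, u < t} := by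
    refine h.isTypeC0L1Over_of_countable_fibers l (fun w => ?_) fun A hA hinj => ?_
    · by_cases hw : w ≤ φ (E w)
      · refine (hX w (φ (E w)) (by
          have : IsSeparable (uIcc w (φ (E w))) := hbase w
          rwa [uIcc_of_le hw] at this)).mono ?_
        rintro t ⟨⟨htX, hte, htu⟩, rfl⟩
        refine ⟨htX, (hl htu).2.le, ?_⟩
        rwa [show E (l t) = E t from separableComponent_eq (hl htu).1]
      · refine countable_empty.mono ?_
        rintro t ⟨⟨htX, hte, htu⟩, rfl⟩
        rw [show E (l t) = E t from separableComponent_eq (hl htu).1] at hw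
        exact hw ((hl htu).2.le.trans hte.le)
    · refine h.isTypeC0L1Over_of_Ioc l (fun t ht => (hl (hA ht).2.2).2) fun t ht t' ht' htt' => ?_
      by_contra hcon
      rw [not_le] at hcon
      have htE : t ∈ E t' := hmem_lt (hl (hA ht').2.2).1 hcon htt'
      have hEE : E t = E t' := separableComponent_eq htE
      refine htt'.ne (hinj ht ht' (hφc _ _ ?_ ⟨?_, hcon⟩))
      · rw [hEE]
        exact inter_subset_inter_right _ (Iio_subset_Iio htt'.le)
      · rw [hEE]
        exact (hl (hA ht').2.2).1
  -- A component has at most one maximum, and the interval chosen for it stays in its component;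
  -- hence no countability is needed.
  have hMax : IsTypeC0L1Over F {t ∈ X | (∀ u ∈ E t, u ≤ t) ∧ ∃ u ∈ E t, u < t} := by
    refine h.isTypeC0L1Over_of_Ioc l (fun t ht => (hl ht.2.2).2) fun t ht t' ht' htt' => ?_
    by_contra hcon
    have htE : t ∈ E t' := hmem_lt (hl ht'.2.2).1 (not_le.1 hcon) htt'
    exact htt'.not_ge (ht.2.1 t' (mem_separableComponent_comm.1 htE))
  have hMin : IsTypeC0L1Over F {t ∈ X | (∀ u ∈ E t, t ≤ u) ∧ ∃ u ∈ E t, t < u} := by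
    refine h.isTypeC0L1Over_of_Ioo r (fun t ht => (hr ht.2.2).2) fun t ht t' ht' htt' => ?_
    by_contra hcon
    have htE : t' ∈ E t := hmem_gt (hr ht.2.2).1 htt' (not_le.1 hcon)
    exact htt'.not_ge (ht'.2.1 t (mem_separableComponent_comm.1 htE))
  refine (h.isTypeC0L1Over_union (h.isTypeC0L1Over_union hUp hDown)
    (h.isTypeC0L1Over_union hMax hMin)).mono fun t ht => ?_
  obtain ⟨u, hu, hut⟩ := (hadj t ht).exists_ne
  rcases le_or_gt (φ (E t)) t with hle | hgt
  · by_cases hgt : ∃ u ∈ E t, t < u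
    · exact .inl (.inl ⟨ht, hle, hgt⟩)
    · push Not at hgt
      exact .inr (.inl ⟨ht, hgt, u, hu, (hgt u hu).lt_of_ne hut⟩)
  · by_cases hlt : ∃ u ∈ E t, u < t
    · exact .inl (.inr ⟨ht, hgt, hlt⟩)
    · push Not at hlt
      exact .inr (.inr ⟨ht, hlt, u, hu, (hlt u hu).lt_of_ne hut.symm⟩)

end IsBoundedNullRepresentation

end Order

end CompactLine

/-! ### Assembly of the cover of `Q` -/

theorem theorem3p7 {K : Type u} [LinearOrder K] [TopologicalSpace K] [OrderTopology K]
    [CompactSpace K] [MeasurableSpace K] [BorelSpace K]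
    (h : ∃ 𝒜 : Set (Set K), 𝒜.Countable ∧ (∀ A ∈ 𝒜, CompactLine.FiniteTwoSidedHeight A) ∧
      {t ∈ CompactLine.internalPoints K | CompactLine.rightCharacter t ≤ ℵ₀ ∧
        ¬ CompactLine.HasSeparableAdjacency t} ⊆ ⋃₀ 𝒜) :
    CompactLine.SeparablyDetermined.{u, v} K := by
  intro I F hF Q hQ
  obtain ⟨𝒜, h𝒜, hheight, hcover⟩ := h
  obtain ⟨μ, M, hμ⟩ := hF.exists_representation
  let X : Set K := {t ∈ Q | (¬ CompactLine.InC0 fun i => F i t) ∧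
    t ∉ CompactLine.rightIsolated K}
  have h1 : CompactLine.IsTypeC0L1Over F {t | CompactLine.InC0 fun i => F i t} :=
    CompactLine.isTypeC0L1Over_of_inC0 fun t ht => ht
  have h2 : CompactLine.IsTypeC0L1Over F {t ∈ X | CompactLine.HasSeparableAdjacency t} :=
    hμ.isTypeC0L1Over_of_hasSeparableAdjacency
      (fun a b hab => (CompactLine.countable_inter_Ico_of_isSeparable hQ hab).mono
        (inter_subset_inter_left _ fun t ht => ht.1))
      fun t ht => ht.2
  have : Countable 𝒜 := h𝒜.to_subtype
  have h3 : CompactLine.IsTypeC0L1Over F (⋃ A : 𝒜, (A : Set K) ∩ CompactLine.internalPoints K) :=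
    hμ.isTypeC0L1Over_of_countable _
      (fun A : 𝒜 => hμ.isTypeC0L1Over_of_finiteTwoSidedHeight (hheight A A.2)) subset_rfl
  refine (hμ.isTypeC0L1Over_union (hμ.isTypeC0L1Over_union h1 h2)
    (hμ.isTypeC0L1Over_union hμ.isTypeC0L1Over_leftIsolated h3)).mono fun t ht => ?_
  by_cases htc : CompactLine.InC0 fun i => F i t
  · exact .inl (.inl htc)
  by_cases htl : t ∈ CompactLine.leftIsolated K
  · exact .inr (.inl htl)
  have htr : t ∉ CompactLine.rightIsolated K := fun hr => htc (hμ.inC0_of_mem_rightIsolated hr)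
  by_cases hadj : CompactLine.HasSeparableAdjacency t
  · exact .inl (.inr ⟨⟨ht, htc, htr⟩, hadj⟩)
  have hti : t ∈ CompactLine.internalPoints K := fun hcon => hcon.elim htr htl
  obtain ⟨A, hA, htA⟩ := hcover ⟨hti, hμ.rightCharacter_le_of_not_inC0 htc, hadj⟩
  exact .inr (.inr (mem_iUnion.2 ⟨⟨A, hA⟩, htA, hti⟩))
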